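/- Let $p\ge 1$, let $S^{p-1}=\{\xi\in\mathbb{R}^p:|\xi|=1\}$, and let $d\Omega_{p-1}$ be the surface measure on $S^{p-1}$. A spherical harmonic of degree $n\in\mathbb{N}_0$ is the restriction to $S^{p-1}$ of a real homogeneous polynomial $H$ of degree $n$ in $p$ variables with $\Delta_p H=\sum_{i=1}^p \partial^2 H/\partial x_i^2=0$ (the zero polynomial is allowed), and $N(p,n)$ denotes the dimension of the real vector space of such polynomials $H$. (1) If $f:S^{p-1}\to\mathbb{R}$ is continuous and $\int_{S^{p-1}} f\,Y\,d\Omega_{p-1}=0$ for every spherical harmonic $Y$ of every degree, then $f(\xi)=0$ for all $\xi\in S^{p-1}$. Moreover, let $S=\{Y_{n,j}: n\in\mathbb{N}_0,\ 1\le j\le N(p,n)\}$ be a maximal orthogonal set of spherical harmonics, i.e. for each $n$ the functions $Y_{n,1},\dots,Y_{n,N(p,n)}$ are nonzero, pairwise orthogonal (with respect to $\int_{S^{p-1}} fg\,d\Omega_{p-1}$) spherical harmonics of degree $n$. Then: (2) If $f:S^{p-1}\to\mathbb{R}$ is continuous and $\int_{S^{p-1}} f(\xi)Y_{n,j}(\xi)\,d\Omega_{p-1}=0$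 for all $n,j$, then $f(\xi)=0$ for all $\xi\in S^{p-1}$. (3) $S$ is closed in $L^2(S^{p-1})$: if $f:S^{p-1}\to\mathbb{R}$ is square-integrable and orthogonal to every $Y_{n,j}$, then $f=0$ almost everywhere. (4) $S$ is complete in $L^2(S^{p-1})$: for every square-integrable $f:S^{p-1}\to\mathbb{R}$ there are real numbers $c_{n,j}$ such that $\sum_{n,j}c_{n,j}Y_{n,j}$ converges to $f$ in the $L^2$ norm, for every order of summation; that is, for every increasing sequence of finite sets $A_0\subseteq A_1\subseteq\cdots$ of indices whose union is the set of all indices $(n,j)$, $$\lim_{k\to\infty}\Big\|f-\sum_{(n,j)\in A_k}c_{n,j}Y_{n,j}\Big\|_{L^2(S^{p-1})}=0.$$ -/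

import Mathlib

open MeasureTheory Filter Topology

/-- The unit sphere `S^{p-1}` in Euclidean space `ℝ^p`. -/
abbrev UnitSphere (p : ℕ) : Type :=
  Metric.sphere (0 : EuclideanSpace ℝ (Fin p)) 1

/-- The surface measure `dΩ_{p-1}` on `S^{p-1}`, normalised (as usual) so that a measurable set `A`
has measure `p` times the volume of the cone `{r ξ : 0 < r < 1, ξ ∈ A}`; in particular the total
mass is `p · vol(B^p) = 2 π^{p/2} / Γ(p/2)`. -/
noncomputable def surfaceMeasure (p : ℕ) : Measure (UnitSphere p) :=
  (volume : Measure (EuclideanSpace ℝ (Fin p))).toSphere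

/-- The Laplace operator `Δ_p = ∑ i, ∂²/∂x_i²` on real polynomials in `p` variables. -/
noncomputable def polyLaplacian (p : ℕ) :
    MvPolynomial (Fin p) ℝ →ₗ[ℝ] MvPolynomial (Fin p) ℝ :=
  ∑ i : Fin p, (MvPolynomial.pderiv i).toLinearMap ∘ₗ (MvPolynomial.pderiv i).toLinearMap

/-- The space of harmonic homogeneous polynomials of degree `n` in `p` variables
(including the zero polynomial). -/
noncomputable def harmonicHomogeneous (p n : ℕ) : Submodule ℝ (MvPolynomial (Fin p) ℝ) :=
  MvPolynomial.homogeneousSubmodule (Fin p) ℝ n ⊓ LinearMap.ker (polyLaplacian p)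

/-- `N(p,n)`: the number of linearly independent harmonic homogeneous polynomials of degree `n`
in `p` variables. -/
noncomputable def harmonicDim (p n : ℕ) : ℕ :=
  Module.finrank ℝ (harmonicHomogeneous p n)

/-- A spherical harmonic of degree `n`: the restriction to `S^{p-1}` of a harmonic homogeneous
polynomial of degree `n` in `p` variables. -/
def IsSphericalHarmonic (p n : ℕ) (Y : UnitSphere p → ℝ) : Prop :=
  ∃ H ∈ harmonicHomogeneous p n,
    ∀ ξ : UnitSphere p, Y ξ = MvPolynomial.eval (fun i => (ξ : EuclideanSpace ℝ (Fin p)) i) H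

/-- A maximal orthogonal system `{Y_{n,j} : n ∈ ℕ, 1 ≤ j ≤ N(p,n)}` of spherical harmonics:
for each degree `n`, exactly `N(p,n)` nonzero, pairwise orthogonal spherical harmonics of
degree `n`. (Orthogonality between different degrees is automatic and is not required here.) -/
structure IsMaximalOrthogonalSystem (p : ℕ)
    (Y : ((n : ℕ) × Fin (harmonicDim p n)) → UnitSphere p → ℝ) : Prop where
  isSphericalHarmonic : ∀ n j, IsSphericalHarmonic p n (Y ⟨n, j⟩)
  ne_zero : ∀ n j, Y ⟨n, j⟩ ≠ 0
  orthogonal : ∀ n i j, i ≠ j → ∫ ξ, Y ⟨n, i⟩ ξ * Y ⟨n, j⟩ ξ ∂(surfaceMeasure p) = 0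

section Systems

variable {X : Type*} [MeasurableSpace X] {ι : Type*}

/-- A family of real functions in `L²(μ)` is closed: the only `f ∈ L²(μ)` orthogonal to every
member is zero (almost everywhere, that is, zero as an element of `L²(μ)`). -/
def IsClosedSystem (μ : Measure X) (φ : ι → X → ℝ) : Prop :=
  (∀ i, MemLp (φ i) 2 μ) ∧
  ∀ f : X → ℝ, MemLp f 2 μ → (∀ i, ∫ x, f x * φ i x ∂μ = 0) → f =ᵐ[μ] 0

/-- A family of real functions in `L²(μ)` is complete: every `f ∈ L²(μ)` has coefficients `c` such
that the partial sums of `∑ c_i φ_i` converge to `f` in the `L²` norm, in whatever order one sums: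
`s` runs over all increasing exhaustions of the index set by finite sets. (For an enumeration
`φ_0, φ_1, …` of the family take `s k = {0, …, k}`; for a double series ordered by degree take for
`s k` the indices of degree at most `k`.) -/
def IsCompleteSystem (μ : Measure X) (φ : ι → X → ℝ) : Prop :=
  (∀ i, MemLp (φ i) 2 μ) ∧
  ∀ f : X → ℝ, MemLp f 2 μ → ∃ c : ι → ℝ,
    ∀ s : ℕ → Finset ι, Monotone s → (∀ i, ∃ k, i ∈ s k) →
      Tendsto (fun k => eLpNorm (fun x => f x - ∑ i ∈ s k, c i * φ i x) 2 μ) atTop (𝓝 0)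

end Systems

/-!
The proof rests on three facts about the sphere.

*Polynomials restrict to sums of spherical harmonics.* For `H` harmonic and homogeneous, the
Laplacian maps `|x|^{2j+2} H` to a positive multiple of `|x|^{2j} H`. So the span of such products
in degree `n + 2` is mapped onto the span in degree `n`, and by induction on the degree every
homogeneous polynomial differs from an element of the span by a harmonic one, that is, it lies in
the span (`homogeneousSubmodule_le_harmonicSpan`). On the sphere `|x|² = 1`, which leaves only the
harmonic factors. With Stone–Weierstrass and the density of continuous functions in `L²`, a
square-integrable function orthogonal to all spherical harmonics vanishes almost everywhere
(`ae_eq_zero_of_orthogonal_sphericalHarmonic`); a continuous one vanishes identically, since the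
surface measure charges every nonempty open set.

*Spherical harmonics of different degrees are orthogonal.* In polar coordinates, the integral of a
homogeneous polynomial over the sphere is, up to a nonzero radial factor, its integral over `ℝ^p`
against `exp(-|x|²)`. Integration by parts for this weight shows that the operator
`Δ - 2 ∑ i, x_i ∂_i` is symmetric, and by Euler's identity harmonic homogeneous polynomials of
degree `n` are eigenvectors of it with eigenvalue `-2n`
(`IsSphericalHarmonic.integral_mul_eq_zero`). Divergence theorems on the ball or the sphere are
thereby avoided.

*An orthogonal family of `N(p,n)` nonzero spherical harmonics of degree `n` spans them all*, because
it is linearly independent (`IsMaximalOrthogonalSystem.exists_eq_sum`). A maximal orthogonal system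
is therefore closed. Being also orthogonal across degrees, it becomes a Hilbert basis of `L²` after
normalisation, whose expansions converge unconditionally (`IsClosedSystem.isCompleteSystem`).
-/

/-! ### Decomposition of homogeneous polynomials into harmonic ones -/

/-- The polynomial `|x|² = ∑ i, x_i²`. -/
noncomputable def polyNormSq (p : ℕ) : MvPolynomial (Fin p) ℝ :=
  ∑ i : Fin p, MvPolynomial.X i ^ 2

lemma polyNormSq_isHomogeneous (p : ℕ) : (polyNormSq p).IsHomogeneous 2 :=
  MvPolynomial.IsHomogeneous.sum _ _ _ fun i _ => by
    simpa using (MvPolynomial.isHomogeneous_X ℝ i).pow 2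

lemma pderiv_polyNormSq (p : ℕ) (i : Fin p) :
    MvPolynomial.pderiv i (polyNormSq p) = 2 * MvPolynomial.X i := by
  simp only [polyNormSq, map_sum, Derivation.leibniz_pow, MvPolynomial.pderiv_X, Pi.single_apply]
  simp [nsmul_eq_mul]

lemma polyLaplacian_apply (p : ℕ) (q : MvPolynomial (Fin p) ℝ) :
    polyLaplacian p q = ∑ i : Fin p, MvPolynomial.pderiv i (MvPolynomial.pderiv i q) := by
  simp [polyLaplacian]

lemma polyLaplacian_isHomogeneous {p n : ℕ} {q : MvPolynomial (Fin p) ℝ}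
    (hq : q.IsHomogeneous n) : (polyLaplacian p q).IsHomogeneous (n - 2) := by
  rw [polyLaplacian_apply]
  exact MvPolynomial.IsHomogeneous.sum _ _ _ fun i _ => hq.pderiv.pderiv

lemma polyLaplacian_eq_zero_of_lt_two {p n : ℕ} {q : MvPolynomial (Fin p) ℝ}
    (hq : q.IsHomogeneous n) (hn : n < 2) : polyLaplacian p q = 0 := by
  rw [polyLaplacian_apply]
  refine Finset.sum_eq_zero fun i _ => ?_
  have h : (MvPolynomial.pderiv i q).IsHomogeneous 0 := by
    have := hq.pderiv (i := i)
    rwa [show n - 1 = 0 by omega] at this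
  rw [← MvPolynomial.totalDegree_zero_iff_isHomogeneous] at h
  rw [MvPolynomial.totalDegree_eq_zero_iff_eq_C.1 h, MvPolynomial.pderiv_C]

/-- The product rule, with the mixed first-order term evaluated by Euler's identity. -/
lemma polyLaplacian_polyNormSq_mul {p n : ℕ} {q : MvPolynomial (Fin p) ℝ}
    (hq : q.IsHomogeneous n) :
    polyLaplacian p (polyNormSq p * q)
      = (2 * p + 4 * n : ℝ) • q + polyNormSq p * polyLaplacian p q := by
  have key : ∀ i : Fin p,
      MvPolynomial.pderiv i (MvPolynomial.pderiv i (polyNormSq p * q))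
        = 2 * q + 4 * (MvPolynomial.X i * MvPolynomial.pderiv i q)
          + polyNormSq p * MvPolynomial.pderiv i (MvPolynomial.pderiv i q) := by
    intro i
    have h2 : MvPolynomial.pderiv i (2 : MvPolynomial (Fin p) ℝ) = 0 := by
      exact MvPolynomial.pderiv_C (R := ℝ) (a := 2) (i := i)
    simp only [MvPolynomial.pderiv_mul, map_add, pderiv_polyNormSq, h2,
      MvPolynomial.pderiv_X_self]
    ring
  rw [polyLaplacian_apply, polyLaplacian_apply, Finset.sum_congr rfl fun i _ => key i,
    Finset.sum_add_distrib, Finset.sum_add_distrib, ← Finset.mul_sum, ← Finset.mul_sum,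
    ← Finset.mul_sum, hq.sum_X_mul_pderiv, MvPolynomial.smul_eq_C_mul]
  simp only [Finset.sum_const, Finset.card_univ, Fintype.card_fin, nsmul_eq_mul, map_add, map_mul,
    map_natCast, map_ofNat]
  ring

/-- On `|x|^{2j} H` with `H` harmonic, multiplication by `|x|²` followed by the Laplacian is a
positive scalar; the scalar is `2 (j + 1) (p + 2 m + 2 j)`. -/
lemma exists_polyLaplacian_polyNormSq_pow_mul {p m : ℕ} (hp : 1 ≤ p) {H : MvPolynomial (Fin p) ℝ}
    (hH : H ∈ harmonicHomogeneous p m) (j : ℕ) :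
    ∃ c : ℝ, 0 < c ∧
      polyLaplacian p (polyNormSq p ^ (j + 1) * H) = c • (polyNormSq p ^ j * H) := by
  have hhom : ∀ j, (polyNormSq p ^ j * H).IsHomogeneous (2 * j + m) := fun j =>
    ((polyNormSq_isHomogeneous p).pow j).mul hH.1
  have hp' : (0 : ℝ) < p := by exact_mod_cast hp
  induction j with
  | zero =>
    refine ⟨2 * p + 4 * m, by positivity, ?_⟩
    have := polyLaplacian_polyNormSq_mul (p := p) (n := m) (q := H) hH.1
    rw [LinearMap.mem_ker.1 hH.2] at this
    simpa using this
  | succ j ih =>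
    obtain ⟨c, hc, h⟩ := ih
    refine ⟨2 * p + 4 * (2 * (j + 1) + m : ℕ) + c, by positivity, ?_⟩
    rw [pow_succ' _ (j + 1), mul_assoc, polyLaplacian_polyNormSq_mul (hhom (j + 1)), h,
      add_smul _ c, mul_smul_comm, ← mul_assoc, ← pow_succ']

/-- The span of the products `|x|^{2j} H` of total degree `n`, with `H` homogeneous and
harmonic. -/
noncomputable def harmonicSpan (p n : ℕ) : Submodule ℝ (MvPolynomial (Fin p) ℝ) :=
  Submodule.span ℝ
    {q | ∃ j m, 2 * j + m = n ∧ ∃ H ∈ harmonicHomogeneous p m, q = polyNormSq p ^ j * H}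

lemma harmonicSpan_le_homogeneousSubmodule (p n : ℕ) :
    harmonicSpan p n ≤ MvPolynomial.homogeneousSubmodule (Fin p) ℝ n := by
  refine Submodule.span_le.2 ?_
  rintro _ ⟨j, m, rfl, H, hH, rfl⟩
  exact ((polyNormSq_isHomogeneous p).pow j).mul hH.1

lemma exists_polyLaplacian_eq_of_mem_harmonicSpan {p n : ℕ} (hp : 1 ≤ p)
    {w : MvPolynomial (Fin p) ℝ} (hw : w ∈ harmonicSpan p n) :
    ∃ v ∈ harmonicSpan p (n + 2), polyLaplacian p v = w := by
  suffices h : harmonicSpan p n ≤ (harmonicSpan p (n + 2)).map (polyLaplacian p) from h hw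
  refine Submodule.span_le.2 ?_
  rintro _ ⟨j, m, rfl, H, hH, rfl⟩
  obtain ⟨c, hc, h⟩ := exists_polyLaplacian_polyNormSq_pow_mul hp hH j
  refine ⟨c⁻¹ • (polyNormSq p ^ (j + 1) * H), Submodule.smul_mem _ _ (Submodule.subset_span
    ⟨j + 1, m, by ring, H, hH, rfl⟩), ?_⟩
  rw [map_smul, h, smul_smul, inv_mul_cancel₀ hc.ne', one_smul]

/-- Every homogeneous polynomial is a sum of products `|x|^{2j} H` with `H` homogeneous and
harmonic. -/
theorem homogeneousSubmodule_le_harmonicSpan {p : ℕ} (hp : 1 ≤ p) (n : ℕ) :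
    MvPolynomial.homogeneousSubmodule (Fin p) ℝ n ≤ harmonicSpan p n := by
  have low : ∀ n < 2, MvPolynomial.homogeneousSubmodule (Fin p) ℝ n ≤ harmonicSpan p n :=
    fun n hn q hq => Submodule.subset_span
      ⟨0, n, by simp, q, ⟨hq, polyLaplacian_eq_zero_of_lt_two hq hn⟩, by simp⟩
  induction n using Nat.twoStepInduction with
  | zero => exact low 0 (by norm_num)
  | one => exact low 1 (by norm_num)
  | more n ih _ =>
    intro q hq
    have hΔ : polyLaplacian p q ∈ harmonicSpan p n := ih (polyLaplacian_isHomogeneous hq)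
    -- Correcting `q` by a preimage `v` of its Laplacian leaves a harmonic polynomial.
    obtain ⟨v, hv, hvq⟩ := exists_polyLaplacian_eq_of_mem_harmonicSpan hp hΔ
    have hdiff : q - v ∈ harmonicSpan p (n + 2) := Submodule.subset_span
      ⟨0, n + 2, by simp, q - v,
        ⟨Submodule.sub_mem _ hq (harmonicSpan_le_homogeneousSubmodule p _ hv), by
          simp [hvq]⟩, by simp⟩
    simpa using Submodule.add_mem _ hdiff hv

/-! ### Integration by parts for the Gaussian weight -/

lemma hasLineDerivAt_eval {p : ℕ} (P : MvPolynomial (Fin p) ℝ) (i : Fin p)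
    (x : EuclideanSpace ℝ (Fin p)) :
    HasLineDerivAt ℝ (fun y : EuclideanSpace ℝ (Fin p) => MvPolynomial.eval (fun k => y k) P)
      (MvPolynomial.eval (fun k => x k) (MvPolynomial.pderiv i P)) x
      (EuclideanSpace.single i 1) := by
  induction P using MvPolynomial.induction_on with
  | C a => simpa [HasLineDerivAt] using hasDerivAt_const (0 : ℝ) a
  | add P Q hP hQ =>
    simp only [HasLineDerivAt, map_add] at *
    exact hP.add hQ
  | mul_X P k hP =>
    have hX : HasDerivAt (fun t : ℝ => (x + t • EuclideanSpace.single i (1 : ℝ)) k)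
        (if k = i then 1 else 0) 0 := by
      refine (((hasDerivAt_id (0 : ℝ)).mul_const (if k = i then (1 : ℝ) else 0)).const_add
        (x k)).congr_deriv (one_mul _) |>.congr_of_eventuallyEq (.of_forall fun t => ?_)
      simp
    simp only [HasLineDerivAt, map_mul, MvPolynomial.eval_X] at *
    refine (hP.mul hX).congr_deriv ?_
    by_cases h : k = i
    · subst h
      simp [add_comm, mul_comm]
    · simp [MvPolynomial.pderiv_X, h, mul_comm]

lemma hasLineDerivAt_gaussian {p : ℕ} (i : Fin p) (x : EuclideanSpace ℝ (Fin p)) :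
    HasLineDerivAt ℝ (fun y : EuclideanSpace ℝ (Fin p) => Real.exp (-‖y‖ ^ 2))
      (-2 * x i * Real.exp (-‖x‖ ^ 2)) x (EuclideanSpace.single i 1) := by
  have h := ((hasStrictFDerivAt_norm_sq x).hasFDerivAt.neg.exp).hasLineDerivAt
    (EuclideanSpace.single i 1)
  refine (HasDerivAt.congr_deriv h ?_ :)
  have hin : inner ℝ x (EuclideanSpace.single i (1 : ℝ)) = x i := by
    simp [EuclideanSpace.inner_single_right]
  simp [hin]
  ring

lemma integrable_norm_pow_mul_gaussian {p : ℕ} (hp : 1 ≤ p) (k : ℕ) :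
    Integrable (fun x : EuclideanSpace ℝ (Fin p) => ‖x‖ ^ k * Real.exp (-‖x‖ ^ 2)) := by
  have : Nonempty (Fin p) := ⟨⟨0, hp⟩⟩
  refine (integrable_fun_norm_addHaar (E := EuclideanSpace ℝ (Fin p)) volume
    (f := fun r : ℝ => r ^ k * Real.exp (-r ^ 2))).2 ?_
  have hs : (-1 : ℝ) < ((p - 1 + k : ℕ) : ℝ) := neg_one_lt_zero.trans_le (Nat.cast_nonneg _)
  have h := (integrable_rpow_mul_exp_neg_mul_sq (b := 1) one_pos hs).integrableOn
    (s := Set.Ioi 0)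
  refine h.congr_fun (fun r _ => ?_) measurableSet_Ioi
  simp only [Real.rpow_natCast, finrank_euclideanSpace, Fintype.card_fin, smul_eq_mul, pow_add]
  ring_nf

lemma continuous_eval_euclidean {p : ℕ} (P : MvPolynomial (Fin p) ℝ) :
    Continuous fun x : EuclideanSpace ℝ (Fin p) => MvPolynomial.eval (fun k => x k) P :=
  (MvPolynomial.continuous_eval P).comp (by fun_prop)

lemma integrable_eval_mul_gaussian {p : ℕ} (hp : 1 ≤ p) (P : MvPolynomial (Fin p) ℝ) :
    Integrable (fun x : EuclideanSpace ℝ (Fin p) =>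
      MvPolynomial.eval (fun k => x k) P * Real.exp (-‖x‖ ^ 2)) := by
  induction P using MvPolynomial.induction_on' with
  | add P Q hP hQ => exact (hP.add hQ).congr (.of_forall fun x => by simp [add_mul])
  | monomial u a =>
    -- A monomial of degree `k` is bounded by a constant times `‖x‖ ^ k`.
    refine ((integrable_norm_pow_mul_gaussian hp (∑ i, u i)).const_mul |a|).mono'
      ((continuous_eval_euclidean _).mul (by fun_prop)).aestronglyMeasurable
      (.of_forall fun x => ?_)
    rw [MvPolynomial.eval_monomial, Finsupp.prod_fintype _ _ (by simp), norm_mul, norm_mul,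
      Real.norm_eq_abs a, Real.norm_of_nonneg (Real.exp_pos _).le, mul_assoc, norm_prod,
      ← Finset.prod_pow_eq_pow_sum]
    gcongr with i
    rw [norm_pow]
    gcongr
    exact PiLp.norm_apply_le x i

/-- Integration by parts against the Gaussian weight. -/
lemma integral_eval_pderiv_mul_gaussian {p : ℕ} (hp : 1 ≤ p) (P : MvPolynomial (Fin p) ℝ)
    (i : Fin p) :
    ∫ x : EuclideanSpace ℝ (Fin p),
        MvPolynomial.eval (fun k => x k) (MvPolynomial.pderiv i P) * Real.exp (-‖x‖ ^ 2)
      = 2 * ∫ x : EuclideanSpace ℝ (Fin p),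
        MvPolynomial.eval (fun k => x k) (MvPolynomial.X i * P) * Real.exp (-‖x‖ ^ 2) := by
  have hint : Integrable (fun x : EuclideanSpace ℝ (Fin p) =>
      MvPolynomial.eval (fun k => x k) P * (-2 * x i * Real.exp (-‖x‖ ^ 2))) := by
    refine ((integrable_eval_mul_gaussian hp (MvPolynomial.X i * P)).const_mul (-2)).congr
      (.of_forall fun x => ?_)
    simp only [map_mul, MvPolynomial.eval_X]
    ring
  have h := integral_bilinear_hasLineDerivAt_right_eq_neg_left_of_integrable
    (μ := (volume : Measure (EuclideanSpace ℝ (Fin p)))) (B := ContinuousLinearMap.mul ℝ ℝ)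
    (integrable_eval_mul_gaussian hp (MvPolynomial.pderiv i P)) hint
    (integrable_eval_mul_gaussian hp P)
    (fun x _ => hasLineDerivAt_eval P i x) (fun x _ => hasLineDerivAt_gaussian i x)
  simp only [ContinuousLinearMap.mul_apply'] at h
  rw [← neg_eq_iff_eq_neg] at h
  rw [← h, ← integral_neg, ← integral_const_mul]
  congr 1 with x
  simp only [map_mul, MvPolynomial.eval_X]
  ring

/-- The Gaussian integral `∫ P(x) exp(-|x|²) dx` as a linear functional on polynomials. -/
noncomputable def gaussianFunctional {p : ℕ} (hp : 1 ≤ p) : MvPolynomial (Fin p) ℝ →ₗ[ℝ] ℝ where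
  toFun P := ∫ x : EuclideanSpace ℝ (Fin p),
    MvPolynomial.eval (fun k => x k) P * Real.exp (-‖x‖ ^ 2)
  map_add' P Q := by
    rw [← integral_add (integrable_eval_mul_gaussian hp P) (integrable_eval_mul_gaussian hp Q)]
    simp only [map_add, add_mul]
  map_smul' c P := by
    simp only [MvPolynomial.smul_eval, mul_assoc, integral_const_mul, RingHom.id_apply, smul_eq_mul]

lemma gaussianFunctional_pderiv {p : ℕ} (hp : 1 ≤ p) (P : MvPolynomial (Fin p) ℝ) (i : Fin p) :
    gaussianFunctional hp (MvPolynomial.pderiv i P)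
      = 2 * gaussianFunctional hp (MvPolynomial.X i * P) :=
  integral_eval_pderiv_mul_gaussian hp P i

/-- Green's identity for the Gaussian weight: for harmonic `G` of degree `n`, Euler's identity turns
the first-order term of the operator `Δ - 2 ∑ i, x_i ∂_i` into the scalar `-2n`. -/
lemma two_mul_degree_mul_gaussianFunctional {p n : ℕ} (hp : 1 ≤ p) (P : MvPolynomial (Fin p) ℝ)
    {G : MvPolynomial (Fin p) ℝ} (hG : G ∈ harmonicHomogeneous p n) :
    2 * n * gaussianFunctional hp (P * G)
      = gaussianFunctional hp (∑ i, MvPolynomial.pderiv i P * MvPolynomial.pderiv i G) := by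
  have hEuler := MvPolynomial.IsHomogeneous.sum_X_mul_pderiv (φ := G) hG.1
  have hΔ : ∑ i, MvPolynomial.pderiv i (MvPolynomial.pderiv i G) = 0 := by
    rw [← polyLaplacian_apply]; exact hG.2
  calc 2 * n * gaussianFunctional hp (P * G)
      = 2 * gaussianFunctional hp (P * (n • G)) := by
        rw [mul_smul_comm, map_nsmul, nsmul_eq_mul]; ring
    _ = ∑ i, gaussianFunctional hp (MvPolynomial.pderiv i (P * MvPolynomial.pderiv i G)) := by
        simp only [gaussianFunctional_pderiv, ← Finset.mul_sum, ← map_sum]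
        rw [← hEuler, Finset.mul_sum]
        simp only [mul_left_comm]
    _ = gaussianFunctional hp (∑ i, MvPolynomial.pderiv i P * MvPolynomial.pderiv i G)
          + gaussianFunctional hp
            (P * ∑ i, MvPolynomial.pderiv i (MvPolynomial.pderiv i G)) := by
        rw [Finset.mul_sum, ← map_add, ← Finset.sum_add_distrib, map_sum]
        simp only [MvPolynomial.pderiv_mul]
    _ = _ := by rw [hΔ, mul_zero, map_zero, add_zero]

/-- The Dirichlet form in `two_mul_degree_mul_gaussianFunctional` is symmetric, so
`2 m I(G H) = 2 n I(G H)`, where `I` is the Gaussian integral. -/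
lemma gaussianFunctional_mul_eq_zero {p m n : ℕ} (hp : 1 ≤ p) (hmn : m ≠ n)
    {G H : MvPolynomial (Fin p) ℝ} (hG : G ∈ harmonicHomogeneous p m)
    (hH : H ∈ harmonicHomogeneous p n) : gaussianFunctional hp (G * H) = 0 := by
  have h₁ := two_mul_degree_mul_gaussianFunctional hp G hH
  have h₂ := two_mul_degree_mul_gaussianFunctional hp H hG
  simp only [mul_comm (MvPolynomial.pderiv _ H)] at h₂
  rw [mul_comm H G, ← h₁] at h₂
  have hne : (2 * m : ℝ) ≠ 2 * n := by simpa using hmn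
  by_contra h0
  exact hne (mul_right_cancel₀ h0 h₂)

/-! ### Polar coordinates and orthogonality of different degrees -/

lemma eval_smul_of_isHomogeneous {p n : ℕ} {P : MvPolynomial (Fin p) ℝ} (hP : P.IsHomogeneous n)
    (r : ℝ) (x : Fin p → ℝ) :
    MvPolynomial.eval (fun k => r * x k) P = r ^ n * MvPolynomial.eval x P := by
  rw [MvPolynomial.eval_eq', MvPolynomial.eval_eq', Finset.mul_sum]
  refine Finset.sum_congr rfl fun d hd => ?_
  have hdeg : ∑ i, d i = n := by
    rw [← hP (MvPolynomial.mem_support_iff.1 hd)]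
    simp [Finsupp.weight_apply, Finsupp.sum_fintype]
  simp only [mul_pow, Finset.prod_mul_distrib, Finset.prod_pow_eq_pow_sum, hdeg]
  ring

instance (p : ℕ) : IsFiniteMeasure (surfaceMeasure p) := by
  unfold surfaceMeasure; infer_instance

instance (p : ℕ) : (surfaceMeasure p).IsOpenPosMeasure := by
  unfold surfaceMeasure; infer_instance

/-- Polar coordinates: the Gaussian integral of a positively homogeneous function is its integral
over the sphere times a radial factor that depends only on the degree of homogeneity. -/
lemma exists_integral_mul_gaussian_eq (p k : ℕ) (hp : 1 ≤ p) :
    ∃ c : ℝ, ∀ F : EuclideanSpace ℝ (Fin p) → ℝ,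
      (∀ (r : ℝ) (x : EuclideanSpace ℝ (Fin p)), 0 < r → F (r • x) = r ^ k * F x) →
      ∫ x, F x * Real.exp (-‖x‖ ^ 2) = (∫ ξ : UnitSphere p, F ξ ∂(surfaceMeasure p)) * c := by
  have : Nonempty (Fin p) := ⟨⟨0, hp⟩⟩
  refine ⟨∫ r : Set.Ioi (0 : ℝ), (r : ℝ) ^ k * Real.exp (-(r : ℝ) ^ 2)
    ∂Measure.volumeIoiPow (Module.finrank ℝ (EuclideanSpace ℝ (Fin p)) - 1), fun F hF => ?_⟩
  calc ∫ x : EuclideanSpace ℝ (Fin p), F x * Real.exp (-‖x‖ ^ 2)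
      = ∫ x : ({(0 : EuclideanSpace ℝ (Fin p))}ᶜ : Set (EuclideanSpace ℝ (Fin p))),
          F x * Real.exp (-‖(x : EuclideanSpace ℝ (Fin p))‖ ^ 2)
          ∂((volume : Measure (EuclideanSpace ℝ (Fin p))).comap (↑)) := by
        rw [integral_subtype_comap (measurableSet_singleton _).compl
          fun x : EuclideanSpace ℝ (Fin p) => F x * Real.exp (-‖x‖ ^ 2), restrict_compl_singleton]
    _ = ∫ z : UnitSphere p × Set.Ioi (0 : ℝ),
          F z.1 * ((z.2 : ℝ) ^ k * Real.exp (-(z.2 : ℝ) ^ 2))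
          ∂((surfaceMeasure p).prod
            (Measure.volumeIoiPow (Module.finrank ℝ (EuclideanSpace ℝ (Fin p)) - 1))) := by
        rw [surfaceMeasure,
          ← (Measure.measurePreserving_homeomorphUnitSphereProd
            (volume : Measure (EuclideanSpace ℝ (Fin p)))).integral_comp
            (Homeomorph.measurableEmbedding _)]
        congr 1 with x
        have hx : 0 < ‖(x : EuclideanSpace ℝ (Fin p))‖ := norm_pos_iff.2 x.2
        have : F x = ‖(x : EuclideanSpace ℝ (Fin p))‖ ^ k *
            F (‖(x : EuclideanSpace ℝ (Fin p))‖⁻¹ • (x : EuclideanSpace ℝ (Fin p))) := by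
          rw [← hF _ _ hx, smul_inv_smul₀ hx.ne']
        simp only [homeomorphUnitSphereProd_apply_fst_coe, homeomorphUnitSphereProd_apply_snd_coe]
        rw [this]
        ring
    _ = _ := integral_prod_mul (fun ξ : UnitSphere p => F ξ)
        fun r : Set.Ioi (0 : ℝ) => (r : ℝ) ^ k * Real.exp (-(r : ℝ) ^ 2)

/-- A positively homogeneous function whose Gaussian integral vanishes has mean zero on the
sphere. -/
lemma integral_sphere_eq_zero_of_integral_gaussian_eq_zero {p k : ℕ} (hp : 1 ≤ p)
    {F : EuclideanSpace ℝ (Fin p) → ℝ}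
    (hF : ∀ (r : ℝ) (x : EuclideanSpace ℝ (Fin p)), 0 < r → F (r • x) = r ^ k * F x)
    (h0 : ∫ x, F x * Real.exp (-‖x‖ ^ 2) = 0) :
    ∫ ξ : UnitSphere p, F ξ ∂(surfaceMeasure p) = 0 := by
  obtain ⟨c, hc⟩ := exists_integral_mul_gaussian_eq p k hp
  -- The radial factor is nonzero because the Gaussian integral of `‖x‖ ^ k` is positive.
  have hnorm := hc (fun x => ‖x‖ ^ k) fun r x hr => by
    rw [norm_smul, mul_pow, Real.norm_of_nonneg hr.le]
  have hpos : 0 < ∫ x : EuclideanSpace ℝ (Fin p), ‖x‖ ^ k * Real.exp (-‖x‖ ^ 2) :=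
    integral_pos_of_integrable_nonneg_nonzero (x := EuclideanSpace.single ⟨0, hp⟩ 1)
      (by fun_prop) (integrable_norm_pow_mul_gaussian hp k) (fun x => by positivity) (by simp)
  have hc0 : c ≠ 0 := by
    rintro rfl
    rw [hnorm, mul_zero] at hpos
    exact hpos.false
  rw [hc F hF] at h0
  exact (mul_eq_zero.1 h0).resolve_right hc0

/-- Spherical harmonics of different degrees are orthogonal. -/
theorem IsSphericalHarmonic.integral_mul_eq_zero {p m n : ℕ} (hp : 1 ≤ p) (hmn : m ≠ n)
    {Y Z : UnitSphere p → ℝ} (hY : IsSphericalHarmonic p m Y) (hZ : IsSphericalHarmonic p n Z) :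
    ∫ ξ, Y ξ * Z ξ ∂(surfaceMeasure p) = 0 := by
  obtain ⟨G, hG, hYG⟩ := hY
  obtain ⟨H, hH, hZH⟩ := hZ
  have hGH : (G * H).IsHomogeneous (m + n) := MvPolynomial.IsHomogeneous.mul hG.1 hH.1
  have h := integral_sphere_eq_zero_of_integral_gaussian_eq_zero hp (k := m + n)
    (F := fun x => MvPolynomial.eval (fun k => x k) (G * H))
    (fun r x _ => ?_) (gaussianFunctional_mul_eq_zero hp hmn hG hH)
  · simpa [hYG, hZH] using h
  · exact eval_smul_of_isHomogeneous hGH r x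

/-! ### Density of spherical harmonics -/

/-- Restriction of polynomial functions to the unit sphere. -/
noncomputable def sphereRestrict (p : ℕ) : MvPolynomial (Fin p) ℝ →ₐ[ℝ] C(UnitSphere p, ℝ) :=
  MvPolynomial.aeval fun i => ⟨fun ξ => (ξ : EuclideanSpace ℝ (Fin p)) i, by fun_prop⟩

lemma sphereRestrict_apply {p : ℕ} (P : MvPolynomial (Fin p) ℝ) (ξ : UnitSphere p) :
    sphereRestrict p P ξ = MvPolynomial.eval (fun i => (ξ : EuclideanSpace ℝ (Fin p)) i) P := by
  induction P using MvPolynomial.induction_on with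
  | C a => simp [sphereRestrict]
  | add P Q hP hQ => simp [hP, hQ]
  | mul_X P i hP =>
    rw [map_mul, map_mul, ContinuousMap.mul_apply, hP]
    simp [sphereRestrict]

lemma isSphericalHarmonic_sphereRestrict {p n : ℕ} {H : MvPolynomial (Fin p) ℝ}
    (hH : H ∈ harmonicHomogeneous p n) : IsSphericalHarmonic p n (sphereRestrict p H) :=
  ⟨H, hH, sphereRestrict_apply H⟩

lemma IsSphericalHarmonic.exists_eq_sphereRestrict {p n : ℕ} {Y : UnitSphere p → ℝ}
    (hY : IsSphericalHarmonic p n Y) : ∃ H ∈ harmonicHomogeneous p n, Y = sphereRestrict p H := by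
  obtain ⟨H, hH, h⟩ := hY
  exact ⟨H, hH, funext fun ξ => by rw [h, sphereRestrict_apply]⟩

lemma IsSphericalHarmonic.continuous {p n : ℕ} {Y : UnitSphere p → ℝ}
    (hY : IsSphericalHarmonic p n Y) : Continuous Y := by
  obtain ⟨H, -, rfl⟩ := hY.exists_eq_sphereRestrict
  exact (sphereRestrict p H).continuous

lemma sphereRestrict_polyNormSq (p : ℕ) : sphereRestrict p (polyNormSq p) = 1 := by
  ext ξ
  have h : ‖(ξ : EuclideanSpace ℝ (Fin p))‖ ^ 2 = 1 := by simp
  rw [EuclideanSpace.real_norm_sq_eq] at h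
  simpa [sphereRestrict_apply, polyNormSq] using h

/-- On the sphere `|x|² = 1`, so every polynomial restricts to a sum of spherical harmonics. -/
lemma sphereRestrict_mem_span {p : ℕ} (hp : 1 ≤ p) (P : MvPolynomial (Fin p) ℝ) :
    sphereRestrict p P ∈ Submodule.span ℝ
      {g : C(UnitSphere p, ℝ) | ∃ n, ∃ H ∈ harmonicHomogeneous p n, g = sphereRestrict p H} := by
  have hle : ∀ n, harmonicSpan p n ≤ (Submodule.span ℝ
      {g : C(UnitSphere p, ℝ) | ∃ n, ∃ H ∈ harmonicHomogeneous p n,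
        g = sphereRestrict p H}).comap (sphereRestrict p).toLinearMap := by
    refine fun n => Submodule.span_le.2 ?_
    rintro _ ⟨j, m, -, H, hH, rfl⟩
    refine Submodule.subset_span ⟨m, H, hH, ?_⟩
    simp [sphereRestrict_polyNormSq]
  rw [← MvPolynomial.sum_homogeneousComponent P, map_sum]
  exact Submodule.sum_mem _ fun n _ => hle n (homogeneousSubmodule_le_harmonicSpan hp n
    (MvPolynomial.homogeneousComponent_isHomogeneous n P))

/-- Stone–Weierstrass: polynomial functions are dense among continuous functions on the sphere. -/
lemma topologicalClosure_range_sphereRestrict (p : ℕ) :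
    (sphereRestrict p).range.topologicalClosure = ⊤ := by
  refine ContinuousMap.subalgebra_topologicalClosure_eq_top_of_separatesPoints _ fun ξ η hne => ?_
  obtain ⟨i, hi⟩ : ∃ i, (ξ : EuclideanSpace ℝ (Fin p)) i ≠ (η : EuclideanSpace ℝ (Fin p)) i := by
    by_contra! h
    exact hne (Subtype.ext (PiLp.ext h))
  exact ⟨_, ⟨_, ⟨MvPolynomial.X i, rfl⟩, rfl⟩, by simpa [sphereRestrict_apply] using hi⟩

lemma inner_memLp_toLp {X : Type*} [MeasurableSpace X] {μ : Measure X} {f g : X → ℝ}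
    (hf : MemLp f 2 μ) (hg : MemLp g 2 μ) :
    inner ℝ (hf.toLp f) (hg.toLp g) = ∫ x, f x * g x ∂μ := by
  rw [L2.inner_def]
  refine integral_congr_ae ?_
  filter_upwards [hf.coeFn_toLp, hg.coeFn_toLp] with x hx hy
  rw [hx, hy]
  exact mul_comm _ _

lemma integral_mul_sum_memLp {X ι : Type*} [MeasurableSpace X] {μ : Measure X} [Fintype ι]
    {f : X → ℝ} {φ : ι → X → ℝ} (hf : MemLp f 2 μ) (hφ : ∀ i, MemLp (φ i) 2 μ) (c : ι → ℝ) :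
    ∫ x, f x * ∑ i, c i * φ i x ∂μ = ∑ i, c i * ∫ x, f x * φ i x ∂μ := by
  have hint : ∀ i, Integrable (fun x => f x * φ i x) μ := fun i => hf.integrable_mul (hφ i)
  simp only [Finset.mul_sum, mul_left_comm (f _)]
  rw [integral_finsetSum _ fun i _ => (hint i).const_mul (c i)]
  simp only [integral_const_mul]

lemma ContinuousMap.memLp_two {X : Type*} [TopologicalSpace X] [CompactSpace X]
    [MeasurableSpace X] [BorelSpace X] {μ : Measure X} [IsFiniteMeasure μ] (g : C(X, ℝ)) :
    MemLp g 2 μ :=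
  MemLp.of_bound g.continuous.aestronglyMeasurable ‖g‖ (.of_forall g.norm_coe_le_norm)

/-- A square-integrable function orthogonal to all spherical harmonics vanishes almost
everywhere. -/
theorem ae_eq_zero_of_orthogonal_sphericalHarmonic {p : ℕ} (hp : 1 ≤ p) {f : UnitSphere p → ℝ}
    (hf : MemLp f 2 (surfaceMeasure p))
    (h : ∀ (n : ℕ) (Y : UnitSphere p → ℝ), IsSphericalHarmonic p n Y →
      ∫ ξ, f ξ * Y ξ ∂(surfaceMeasure p) = 0) : f =ᵐ[surfaceMeasure p] 0 := by
  -- The functional `g ↦ ⟪f, g⟫` is continuous on `C(S)`, so its kernel is closed.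
  set ℓ : C(UnitSphere p, ℝ) →L[ℝ] ℝ :=
    (innerSL ℝ (hf.toLp f)) ∘L (ContinuousMap.toLp 2 (surfaceMeasure p) ℝ) with hℓ
  have hker : ∀ P, sphereRestrict p P ∈ LinearMap.ker ℓ.toLinearMap := by
    refine fun P => (Submodule.span_le.2 ?_ : Submodule.span ℝ _ ≤ _) (sphereRestrict_mem_span hp P)
    rintro _ ⟨n, H, hH, rfl⟩
    exact (inner_memLp_toLp hf (sphereRestrict p H).memLp_two).trans
      (h n _ (isSphericalHarmonic_sphereRestrict hH))
  have hzero : ∀ g, ℓ g = 0 := by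
    intro g
    have hg : g ∈ (sphereRestrict p).range.topologicalClosure := by
      rw [topologicalClosure_range_sphereRestrict]; trivial
    refine closure_minimal ?_ (isClosed_singleton.preimage ℓ.continuous) hg
    rintro _ ⟨P, rfl⟩
    exact hker P
  have hdense := ContinuousMap.toLp_denseRange ℝ (surfaceMeasure p) ℝ
    (p := 2) (by norm_num : (2 : ENNReal) ≠ ⊤)
  have hf0 : hf.toLp f = 0 := by
    refine ext_inner_right ℝ fun v => ?_
    rw [inner_zero_left]
    refine hdense.induction_on (p := fun v => inner ℝ (hf.toLp f) v = 0) v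
      (isClosed_eq (by fun_prop) continuous_const) hzero
  exact (hf.coeFn_toLp.symm.trans (by rw [hf0])).trans (Lp.coeFn_zero ..)

/-! ### Maximal orthogonal systems -/

instance (p n : ℕ) : FiniteDimensional ℝ (harmonicHomogeneous p n) := by
  have : FiniteDimensional ℝ (MvPolynomial.homogeneousSubmodule (Fin p) ℝ n) :=
    Module.Finite.iff_fg.2 (MvPolynomial.homogeneousSubmodule_fg (Fin p) ℝ n)
  exact Submodule.finiteDimensional_inf_left _ _

namespace IsMaximalOrthogonalSystem

variable {p : ℕ} {Y : ((n : ℕ) × Fin (harmonicDim p n)) → UnitSphere p → ℝ}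

lemma continuous (hY : IsMaximalOrthogonalSystem p Y) (i) : Continuous (Y i) :=
  (hY.isSphericalHarmonic i.1 i.2).continuous

lemma memLp (hY : IsMaximalOrthogonalSystem p Y) (i) : MemLp (Y i) 2 (surfaceMeasure p) :=
  ContinuousMap.memLp_two ⟨Y i, hY.continuous i⟩

lemma not_ae_eq_zero (hY : IsMaximalOrthogonalSystem p Y) (i) : ¬ Y i =ᵐ[surfaceMeasure p] 0 :=
  fun h => hY.ne_zero i.1 i.2 ((hY.continuous i).ae_eq_iff_eq _ continuous_zero |>.1 h)

lemma integral_mul_eq_zero (hp : 1 ≤ p) (hY : IsMaximalOrthogonalSystem p Y) {i j}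
    (hij : i ≠ j) : ∫ ξ, Y i ξ * Y j ξ ∂(surfaceMeasure p) = 0 := by
  obtain ⟨m, a⟩ := i
  obtain ⟨n, b⟩ := j
  by_cases hmn : m = n
  · subst hmn
    exact hY.orthogonal m a b fun hab => hij (by rw [hab])
  · exact (hY.isSphericalHarmonic m a).integral_mul_eq_zero hp hmn (hY.isSphericalHarmonic n b)

lemma integral_mul_self_ne_zero (hY : IsMaximalOrthogonalSystem p Y) (i) :
    ∫ ξ, Y i ξ * Y i ξ ∂(surfaceMeasure p) ≠ 0 := by
  intro h
  rw [← inner_memLp_toLp (hY.memLp i) (hY.memLp i), inner_self_eq_zero] at h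
  exact hY.not_ae_eq_zero i ((MemLp.toLp_eq_toLp_iff (hY.memLp i) MemLp.zero).1 h)

/-- The members of degree `n` are linearly independent by orthogonality, hence span all spherical
harmonics of degree `n` because there are `N(p,n)` of them. -/
lemma exists_eq_sum (hY : IsMaximalOrthogonalSystem p Y) {n : ℕ} {Z : UnitSphere p → ℝ}
    (hZ : IsSphericalHarmonic p n Z) :
    ∃ c : Fin (harmonicDim p n) → ℝ, ∀ ξ, Z ξ = ∑ j, c j * Y ⟨n, j⟩ ξ := by
  choose H hH hYH using fun j => (hY.isSphericalHarmonic n j).exists_eq_sphereRestrict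
  obtain ⟨G, hG, rfl⟩ := hZ.exists_eq_sphereRestrict
  have hsum : ∀ (c : Fin (harmonicDim p n) → ℝ) (ξ : UnitSphere p),
      sphereRestrict p (∑ j, c j • H j) ξ = ∑ j, c j * Y ⟨n, j⟩ ξ := by
    intro c ξ
    simp [hYH]
  let v : Fin (harmonicDim p n) → harmonicHomogeneous p n := fun j => ⟨H j, hH j⟩
  have hv : ∀ c : Fin (harmonicDim p n) → ℝ,
      ((∑ j, c j • v j : harmonicHomogeneous p n) : MvPolynomial (Fin p) ℝ) = ∑ j, c j • H j := by
    intro c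
    simp [v]
  have hli : LinearIndependent ℝ v := by
    refine Fintype.linearIndependent_iff.2 fun c hc k => ?_
    have h0 : ∀ ξ, ∑ j, c j * Y ⟨n, j⟩ ξ = 0 := fun ξ => by
      rw [← hsum, ← hv, hc]; simp
    have hint := integral_mul_sum_memLp (hY.memLp ⟨n, k⟩) (fun j => hY.memLp ⟨n, j⟩) c
    rw [Finset.sum_eq_single k (fun j _ hj => by rw [hY.orthogonal n k j hj.symm, mul_zero])
      (by simp)] at hint
    simp only [h0, mul_zero, integral_zero] at hint
    exact (mul_eq_zero.1 hint.symm).resolve_right (hY.integral_mul_self_ne_zero _)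
  have hspan := hli.span_eq_top_of_card_eq_finrank' (Fintype.card_fin _)
  have hmem : (⟨G, hG⟩ : harmonicHomogeneous p n) ∈ Submodule.span ℝ (Set.range v) := by
    rw [hspan]; trivial
  obtain ⟨c, hc⟩ := (Submodule.mem_span_range_iff_exists_fun ℝ).1 hmem
  refine ⟨c, fun ξ => ?_⟩
  rw [← hsum, ← hv, hc]

lemma orthogonal_sphericalHarmonic (hY : IsMaximalOrthogonalSystem p Y) {f : UnitSphere p → ℝ}
    (hf : MemLp f 2 (surfaceMeasure p))
    (h : ∀ i, ∫ ξ, f ξ * Y i ξ ∂(surfaceMeasure p) = 0) (n : ℕ) (Z : UnitSphere p → ℝ)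
    (hZ : IsSphericalHarmonic p n Z) : ∫ ξ, f ξ * Z ξ ∂(surfaceMeasure p) = 0 := by
  obtain ⟨c, hc⟩ := hY.exists_eq_sum hZ
  simp only [hc]
  rw [integral_mul_sum_memLp hf (fun j => hY.memLp ⟨n, j⟩) c]
  simp [h]

theorem isClosedSystem (hp : 1 ≤ p) (hY : IsMaximalOrthogonalSystem p Y) :
    IsClosedSystem (surfaceMeasure p) Y :=
  ⟨hY.memLp, fun _ hf h => ae_eq_zero_of_orthogonal_sphericalHarmonic hp hf
    (hY.orthogonal_sphericalHarmonic hf h)⟩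

end IsMaximalOrthogonalSystem

/-! ### Completeness -/

/-- A closed orthogonal system of nonzero functions becomes a Hilbert basis of `L²` after
normalisation, so it is complete. -/
theorem IsClosedSystem.isCompleteSystem {X ι : Type*} [MeasurableSpace X] {μ : Measure X}
    {φ : ι → X → ℝ} (hφ : IsClosedSystem μ φ) (hne : ∀ i, ¬ φ i =ᵐ[μ] 0)
    (horth : ∀ i j, i ≠ j → ∫ x, φ i x * φ j x ∂μ = 0) : IsCompleteSystem μ φ := by
  obtain ⟨hL, hclosed⟩ := hφ
  refine ⟨hL, fun f hf => ?_⟩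
  let v : ι → Lp ℝ 2 μ := fun i => (hL i).toLp (φ i)
  have hv0 : ∀ i, ‖v i‖ ≠ 0 := fun i h => hne i
    ((MemLp.toLp_eq_toLp_iff (hL i) MemLp.zero).1 (norm_eq_zero.1 h))
  have hortho : Orthonormal ℝ fun i => ‖v i‖⁻¹ • v i := by
    refine ⟨fun i => ?_, fun i j hij => ?_⟩
    · rw [norm_smul, norm_inv, norm_norm, inv_mul_cancel₀ (hv0 i)]
    · change inner ℝ (‖v i‖⁻¹ • v i) (‖v j‖⁻¹ • v j) = 0
      rw [inner_smul_left, inner_smul_right, inner_memLp_toLp, horth i j hij, mul_zero, mul_zero]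
  have hbot : (Submodule.span ℝ (Set.range fun i => ‖v i‖⁻¹ • v i))ᗮ = ⊥ := by
    refine (Submodule.eq_bot_iff _).2 fun g hg => ?_
    have hgL : MemLp g 2 μ := Lp.memLp g
    refine (Lp.eq_zero_iff_ae_eq_zero).2 (hclosed g hgL fun i => ?_)
    have h := Submodule.inner_left_of_mem_orthogonal (Submodule.subset_span (Set.mem_range_self i)) hg
    rw [inner_smul_right] at h
    have h' := (mul_eq_zero.1 h).resolve_left (inv_ne_zero (hv0 i))
    rwa [← Lp.toLp_coeFn g hgL, inner_memLp_toLp] at h'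
  let b := HilbertBasis.mkOfOrthogonalEqBot hortho hbot
  let c : ι → ℝ := fun i => b.repr (hf.toLp f) i * ‖v i‖⁻¹
  have hsum : HasSum (fun i => c i • v i) (hf.toLp f) := by
    have h := b.hasSum_repr (hf.toLp f)
    simpa only [b, HilbertBasis.coe_mkOfOrthogonalEqBot, smul_smul] using h
  refine ⟨c, fun s hs hex => ?_⟩
  have hlim := hsum.comp (tendsto_atTop_finset_of_monotone hs hex)
  have hmem : ∀ t : Finset ι, MemLp (fun x => ∑ i ∈ t, c i * φ i x) 2 μ := fun t =>
    memLp_finsetSum t fun i _ => (hL i).const_mul (c i)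
  have hcoe : ∀ t : Finset ι, ∑ i ∈ t, c i • v i = (hmem t).toLp _ := by
    intro t
    refine Lp.ext ?_
    filter_upwards [(hmem t).coeFn_toLp, Lp.coeFn_finsetSum t fun i => c i • v i,
      (eventually_all_finset t).2 fun i _ => Lp.coeFn_smul (c i) (v i),
      (eventually_all_finset t).2 fun i _ => (hL i).coeFn_toLp] with x h1 h2 h3 h4
    rw [h1, h2, Finset.sum_apply]
    refine Finset.sum_congr rfl fun i hi => ?_
    rw [h3 i hi, Pi.smul_apply, h4 i hi, smul_eq_mul]
  have hlim' : Tendsto (fun k => (hmem (s k)).toLp _) atTop (𝓝 (hf.toLp f)) := by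
    simpa only [Function.comp_def, hcoe] using hlim
  rw [tendsto_iff_edist_tendsto_0] at hlim'
  refine hlim'.congr fun k => ?_
  rw [edist_comm, Lp.edist_toLp_toLp]
  rfl

theorem mainTheorem8 (p : ℕ) (hp : 1 ≤ p) :
    (∀ f : UnitSphere p → ℝ, Continuous f →
      (∀ (n : ℕ) (Y : UnitSphere p → ℝ), IsSphericalHarmonic p n Y →
        ∫ ξ, f ξ * Y ξ ∂(surfaceMeasure p) = 0) →
      ∀ ξ, f ξ = 0) ∧
    ∀ Y : ((n : ℕ) × Fin (harmonicDim p n)) → UnitSphere p → ℝ,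
      IsMaximalOrthogonalSystem p Y →
        (∀ f : UnitSphere p → ℝ, Continuous f →
          (∀ n j, ∫ ξ, f ξ * Y ⟨n, j⟩ ξ ∂(surfaceMeasure p) = 0) →
          ∀ ξ, f ξ = 0) ∧
        IsClosedSystem (surfaceMeasure p) Y ∧
        IsCompleteSystem (surfaceMeasure p) Y := by
  have hcont : ∀ f : UnitSphere p → ℝ, Continuous f →
      (∀ (n : ℕ) (Y : UnitSphere p → ℝ), IsSphericalHarmonic p n Y →
        ∫ ξ, f ξ * Y ξ ∂(surfaceMeasure p) = 0) → ∀ ξ, f ξ = 0 := fun f hf h =>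
    congrFun ((hf.ae_eq_iff_eq _ continuous_zero).1
      (ae_eq_zero_of_orthogonal_sphericalHarmonic hp (ContinuousMap.memLp_two ⟨f, hf⟩) h))
  refine ⟨hcont, fun Y hY => ⟨fun f hf h => hcont f hf ?_, hY.isClosedSystem hp,
    (hY.isClosedSystem hp).isCompleteSystem hY.not_ae_eq_zero fun i j =>
      hY.integral_mul_eq_zero hp⟩⟩
  exact hY.orthogonal_sphericalHarmonic (ContinuousMap.memLp_two ⟨f, hf⟩) fun i => h i.1 i.2
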